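/- All graphs are finite, simple and connected. For such a graph $G$ on $n_G\ge 2$ vertices with $m$ edges, let $P$ be the transition matrix of the lazy random walk on $G$ (stay with probability $1/2$, otherwise move to a uniform neighbour), $\pi(y)=\deg(y)/2m$, and $$t_{\mathrm{unif}}(G)=\inf\Big\{t\ge 0:\ \max_{x,y}\Big|\frac{P^t(x,y)}{\pi(y)}-1\Big|\le \tfrac14\Big\}.$$ Let $\mathcal C$ be the class of graphs $G$ with $t_{\mathrm{unif}}(G)\le(\log n_G)^3$. For a sequence of vertices $(u_0,\dots,u_t)$, its profile $\Phi(u_0,\dots,u_t)$ is the pair $\big((r_i)_{i\le t},(\deg(u_i))_{i\le t}\big)$, where $r_i$ is the number of distinct vertices in the sequence up to and including the first occurrence of $u_i$. Profiles take values in $\mathcal S=\bigcup_{t\ge1}\mathbb N^{2t}$. Given a restarting rule $\textsc{restart}:\mathcal S\to\{0,1\}$ and a vertex $x$, the random walk with restarts from $x$ is the process with $X_0=x$ such that, given $X_0,\dots,X_t$, one has $X_{t+1}=x$ if $\textsc{restart}(\Phi(X_0,\dots,X_t))=1$, and otherwise $X_{t+1}$ is obtained from $X_t$ by a random walk step; its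 law is denoted $\mathbb P^G_x$. For $\textsc{stop}:\mathcal S\to\{0,1\}$ let $\tau=\inf\{t\ge0:\ \textsc{stop}(\Phi(X_0,\dots,X_t))=1\}\in\mathbb N\cup\{\infty\}$. **Proposition.** There exists $\delta>0$ such that, whether the random walk steps are those of the simple or of the lazy random walk, for all functions $\textsc{restart},\textsc{stop}:\mathcal S\to\{0,1\}$ and $\textsc{est}:\mathcal S\to\mathbb R$, there are infinitely many $n$ for which there exist a graph $G\in\mathcal C$ with $n_G=n$ vertices and a vertex $x\in V(G)$ with $$\mathbb P^G_x\left(\{\tau\ge\delta n_G\}\cup\left\{\left|\frac{\textsc{est}(\Phi(X_0,\dots,X_\tau))}{n_G}-1\right|>\frac12\right\}\right)\ge\frac14 .$$ -/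

import Mathlib

open MeasureTheory ProbabilityTheory
open scoped ENNReal

namespace SelfStopping

noncomputable section

open scoped Classical in
/-- One step of the simple random walk on `G` from `v`: a uniformly chosen neighbour of `v`
(the walk stays put at an isolated vertex). -/
def simpleStep {V : Type} [Fintype V] (G : SimpleGraph V) (v : V) : PMF V :=
  if h : (G.neighborFinset v).Nonempty then PMF.uniformOfFinset (G.neighborFinset v) h
  else PMF.pure v

/-- One step of the lazy random walk on `G` from `v`: with a fair coin, either stay at `v`
or make a step of the simple random walk. -/
def lazyStep {V : Type} [Fintype V] (G : SimpleGraph V) (v : V) : PMF V :=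
  (PMF.uniformOfFintype Bool).bind fun stay => if stay then PMF.pure v else simpleStep G v

/-- A step of the lazy random walk (`lazy = true`) or of the simple random walk
(`lazy = false`). -/
def walkStep {V : Type} [Fintype V] (lazy : Bool) (G : SimpleGraph V) (v : V) : PMF V :=
  if lazy then lazyStep G v else simpleStep G v

/-- The transition matrix of the lazy random walk. -/
def transitionMatrix {V : Type} [Fintype V] (G : SimpleGraph V) : Matrix V V ℝ :=
  Matrix.of fun x y => (lazyStep G x y).toReal

open scoped Classical in
/-- The stationary distribution `π(y) = deg(y) / (2m)`, `m` being the number of edges. -/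
def stationary {V : Type} [Fintype V] (G : SimpleGraph V) (y : V) : ℝ :=
  (G.degree y : ℝ) / (2 * (G.edgeFinset.card : ℝ))

open scoped Classical in
/-- The uniform mixing time: the least `t` with `|P ^ t (x, y) / π(y) - 1| ≤ 1/4` for all
`x`, `y` (`⊤` if there is none). -/
def uniformMixingTime {V : Type} [Fintype V] (G : SimpleGraph V) : ℕ∞ :=
  ⨅ (t : ℕ) (_ : ∀ x y : V,
    |(transitionMatrix G ^ t) x y / stationary G y - 1| ≤ 1 / 4), (t : ℕ∞)

/-- The space of profiles: pairs of sequences of natural numbers, of a common length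
`t + 1 ≥ 1`. -/
abbrev ProfileSpace : Type := Σ t : ℕ, (Fin (t + 1) → ℕ) × (Fin (t + 1) → ℕ)

open scoped Classical in
/-- The rank of occurrence of `u i` in the sequence `u`: the number of distinct entries seen up
to and including the first occurrence of the value `u i`. Thus `(g,a,a,c,g,d,a,b,d)` is turned
into `(1,2,2,3,1,4,2,5,4)`. -/
def occurrenceRank {V : Type} {t : ℕ} (u : Fin (t + 1) → V) (i : Fin (t + 1)) : ℕ :=
  ((Finset.univ.filter fun j : Fin (t + 1) => ∀ k < j, u k ≠ u i).image u).card

open scoped Classical in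
/-- The profile of a nonempty finite sequence of vertices: its ranks of occurrence and the
degrees of its entries. -/
def profile {V : Type} [Fintype V] (G : SimpleGraph V) {t : ℕ} (u : Fin (t + 1) → V) :
    ProfileSpace :=
  ⟨t, occurrenceRank u, fun i => G.degree (u i)⟩

/-- The profile of the trajectory `X₀, …, X_t`. -/
def profileUpTo {V : Type} [Fintype V] (G : SimpleGraph V) (X : ℕ → V) (t : ℕ) : ProfileSpace :=
  profile G fun i : Fin (t + 1) => X i

/-- The law of `X_{t+1}` given `X₀, …, X_t`, for the walk started at `x` and restarted
according to the rule `restart`: jump back to `x` if the rule says so on the profile of the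
trajectory so far, make a walk step from `X_t` otherwise. -/
def restartStep {V : Type} [Fintype V] (lazy : Bool) (G : SimpleGraph V)
    (restart : ProfileSpace → Bool) (x : V) (t : ℕ) (u : Fin (t + 1) → V) : PMF V :=
  if restart (profile G u) then PMF.pure x else walkStep lazy G (u (Fin.last t))

/-- The step of the walk with restarts at time `t`, as a Markov kernel. -/
def restartKernel {V : Type} [Fintype V] [MeasurableSpace V] [DiscreteMeasurableSpace V]
    (lazy : Bool) (G : SimpleGraph V) (restart : ProfileSpace → Bool) (x : V) (t : ℕ) :
    Kernel ((i : Finset.Iic t) → (fun _ : ℕ => V) i) V :=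
  Kernel.ofFunOfCountable fun u => (restartStep lazy G restart x t
    fun i => u ⟨i, Finset.mem_Iic.2 (Nat.lt_succ_iff.1 i.2)⟩).toMeasure

instance {V : Type} [Fintype V] [MeasurableSpace V] [DiscreteMeasurableSpace V]
    (lazy : Bool) (G : SimpleGraph V) (restart : ProfileSpace → Bool) (x : V) (t : ℕ) :
    IsMarkovKernel (restartKernel lazy G restart x t) :=
  ⟨fun u => by
    change IsProbabilityMeasure (PMF.toMeasure _)
    infer_instance⟩

/-- The law, on the space of infinite trajectories, of the random walk with restarts started
at `x`. -/
def restartWalkLaw {V : Type} [Fintype V] [MeasurableSpace V] [DiscreteMeasurableSpace V]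
    (lazy : Bool) (G : SimpleGraph V) (restart : ProfileSpace → Bool) (x : V) :
    Measure (ℕ → V) :=
  Kernel.trajMeasure (X := fun _ : ℕ => V) (Measure.dirac x) (restartKernel lazy G restart x)

/-- The first time `t` at which `halt` accepts the profile of `X₀, …, X_t`
(`⊤` if it never does). -/
def stoppingTime {V : Type} [Fintype V] (G : SimpleGraph V) (halt : ProfileSpace → Bool)
    (X : ℕ → V) : ℕ∞ :=
  ⨅ (t : ℕ) (_ : halt (profileUpTo G X t) = true), (t : ℕ∞)

/-- The value `est (Φ(X₀, …, X_τ))` returned at the stopping time `τ` (meaningful for finite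
`τ` only). -/
def returnedValue {V : Type} [Fintype V] (G : SimpleGraph V) (halt : ProfileSpace → Bool)
    (est : ProfileSpace → ℝ) (X : ℕ → V) : ℝ :=
  est (profileUpTo G X (stoppingTime G halt X).toNat)

end

end SelfStopping

/-! Compare the clique on `N` vertices with the same clique after `3 * N` leaves have been attached
to one vertex, the hub; the second graph has `4 * N` vertices. Only the hub can tell them apart:
every other clique vertex has the same degree and the same neighbours in both. From a starting
vertex `x` other than the hub, the two walks with restarts therefore give equal probability to every
trajectory that avoids the hub, with equal profiles.

A walk step reaches the hub of the clique with probability at most `1 / (N - 1)`, and a restart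
never does, so by a union bound the hub is missed during the first `N / 4` steps with probability at
least `1/2` (`restartWalkLaw_hit_le`). If such a trajectory stops before time `N / 4` with an answer
within `N / 2` of `N`, its copy in the larger graph stops at the same time with the same answer, at
most `3 * N / 2`, which is wrong for `4 * N` (`restartWalkLaw_le_comp`). The two failure
probabilities thus add up to at least `1/2`, and one of them is at least `1/4` (`failure_hubGraph`).
Hence `δ = 1/4`.

Both graphs mix in `O(log n)` steps: two lazy steps dominate `1/16` of the stationary distribution
(`minorization_hubGraph`), and Doeblin's argument then gives geometric convergence. -/

namespace SelfStopping

/-! ### One-step transition probabilities -/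

section Steps

variable {V : Type} [Fintype V] (G : SimpleGraph V)

open scoped Classical in
lemma simpleStep_apply {v : V} (hv : 0 < G.degree v) (w : V) :
    simpleStep G v w = if G.Adj v w then ((G.degree v : ℕ) : ℝ≥0∞)⁻¹ else 0 := by
  have h : (G.neighborFinset v).Nonempty := by
    rw [← Finset.card_pos]; exact hv
  rw [simpleStep, dif_pos h, PMF.uniformOfFinset_apply]
  simp [SimpleGraph.card_neighborFinset_eq_degree]

lemma lazyStep_apply (v w : V) :
    lazyStep G v w = 2⁻¹ * PMF.pure v w + 2⁻¹ * simpleStep G v w := by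
  rw [lazyStep, PMF.bind_apply, tsum_fintype]
  simp [PMF.uniformOfFintype_apply]

lemma walkStep_apply_le (lazy : Bool) {v w : V} (h : w ≠ v) :
    walkStep lazy G v w ≤ simpleStep G v w := by
  cases lazy
  · exact le_rfl
  · have : walkStep true G v w = 2⁻¹ * simpleStep G v w := by
      simp [walkStep, lazyStep_apply, PMF.pure_apply, h]
    rw [this]
    exact mul_le_of_le_one_left' (by simp)

end Steps

/-! ### Cylinder probabilities of the walk with restarts -/

section Trajectories

lemma measurableSet_cylinder {V : Type} [MeasurableSpace V] [DiscreteMeasurableSpace V]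
    (u : ℕ → V) (t : ℕ) : MeasurableSet {X : ℕ → V | ∀ i ≤ t, X i = u i} := by
  have : {X : ℕ → V | ∀ i ≤ t, X i = u i} = ⋂ i, ⋂ (_ : i ≤ t), (fun X => X i) ⁻¹' {u i} := by
    ext; simp
  rw [this]
  exact MeasurableSet.iInter fun i => MeasurableSet.iInter fun _ =>
    measurable_pi_apply i (MeasurableSet.of_discrete)

variable {V : Type} [Fintype V] [MeasurableSpace V] [DiscreteMeasurableSpace V]
  (lazy : Bool) (G : SimpleGraph V) (restart : ProfileSpace → Bool) (x : V)

instance : IsProbabilityMeasure (restartWalkLaw lazy G restart x) := by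
  unfold restartWalkLaw; infer_instance

/-- The chain rule, obtained by evaluating the disintegration of the trajectory measure at time `t`
on the rectangle of singletons. Together with the law of the starting point, it is all that is used
about the infinite-horizon measure. -/
lemma restartWalkLaw_cylinder_succ (u : ℕ → V) (t : ℕ) :
    restartWalkLaw lazy G restart x {X | ∀ i ≤ t + 1, X i = u i} =
      restartWalkLaw lazy G restart x {X | ∀ i ≤ t, X i = u i} *
        restartStep lazy G restart x t (fun i => u i) (u (t + 1)) := by
  have key := Kernel.map_frestrictLe_trajMeasure_compProd_eq_map_trajMeasure
    (X := fun _ : ℕ => V) (μ₀ := Measure.dirac x) (κ := restartKernel lazy G restart x) (a := t)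
  have hA : MeasurableSet ({Preorder.frestrictLe t u} : Set ((i : Finset.Iic t) → V)) :=
    MeasurableSet.singleton _
  have hB : MeasurableSet ({u (t + 1)} : Set V) := MeasurableSet.of_discrete
  have h := congrArg (fun μ => μ (({Preorder.frestrictLe t u} : Set ((i : Finset.Iic t) → V)) ×ˢ
    ({u (t + 1)} : Set V))) key
  beta_reduce at h
  rw [Measure.compProd_apply_prod hA hB, Measure.map_apply (by fun_prop) (hA.prod hB),
    Measure.restrict_singleton, lintegral_smul_measure, lintegral_dirac' _ (Kernel.measurable_coe _ hB),
    Measure.map_apply (by fun_prop) hA] at h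
  have e1 : (fun X : ℕ → V => (Preorder.frestrictLe (π := fun _ : ℕ => V) t X, X (t + 1))) ⁻¹'
      (({Preorder.frestrictLe t u} : Set ((i : Finset.Iic t) → V)) ×ˢ ({u (t + 1)} : Set V)) =
      {X | ∀ i ≤ t + 1, X i = u i} := by
    ext X
    simp only [Set.mem_preimage, Set.mem_prod, Set.mem_singleton_iff, Set.mem_ofPred_eq, funext_iff,
      Preorder.frestrictLe_apply, Subtype.forall, Finset.mem_Iic]
    constructor
    · rintro ⟨h1, h2⟩ i hi
      rcases Nat.le_succ_iff.1 hi with h | rfl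
      · exact h1 i h
      · exact h2
    · exact fun h => ⟨fun i hi => h i (by omega), h _ le_rfl⟩
  have e2 : (Preorder.frestrictLe (π := fun _ : ℕ => V) t) ⁻¹'
      ({Preorder.frestrictLe t u} : Set ((i : Finset.Iic t) → V)) =
      {X | ∀ i ≤ t, X i = u i} := by
    ext X
    simp [funext_iff]
  rw [e1, e2] at h
  unfold restartWalkLaw
  rw [← h, smul_eq_mul]
  congr 1
  exact PMF.toMeasure_apply_singleton (restartStep lazy G restart x t fun i => u i) _ hB

lemma restartWalkLaw_map_eval_zero :
    (restartWalkLaw lazy G restart x).map (fun X => X 0) = Measure.dirac x := by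
  have hfac : (fun X : ℕ → V => X 0) =
      (fun y : (i : Finset.Iic 0) → V => y ⟨0, Finset.mem_Iic.2 le_rfl⟩) ∘
        Preorder.frestrictLe (π := fun _ : ℕ => V) 0 := rfl
  unfold restartWalkLaw Kernel.trajMeasure
  rw [Measure.map_dirac' (MeasurableEquiv.measurable _), Measure.dirac_bind (Kernel.measurable _),
    hfac, ← Measure.map_map (by fun_prop) (by fun_prop), Kernel.traj_map_frestrictLe_apply,
    Kernel.partialTraj_zero, Kernel.deterministic_apply, Measure.map_dirac' (by fun_prop)]
  rfl

lemma restartWalkLaw_start (s : Set V) :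
    restartWalkLaw lazy G restart x {X | X 0 ∈ s} = s.indicator 1 x := by
  rw [← Measure.dirac_apply' x (MeasurableSet.of_discrete (s := s)),
    ← restartWalkLaw_map_eval_zero lazy G restart x,
    Measure.map_apply (by fun_prop) MeasurableSet.of_discrete]
  rfl

end Trajectories

/-! ### Equal laws of trajectories under an embedding -/

section Comparison

/-- Ranks depend only on which entries coincide, and an injection preserves that. -/
lemma occurrenceRank_comp {V W : Type} (f : V → W) (hf : f.Injective) {t : ℕ} (u : Fin (t + 1) → V) :
    occurrenceRank (fun i => f (u i)) = occurrenceRank u := by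
  classical
  funext i
  unfold occurrenceRank
  rw [← Finset.card_image_of_injective _ hf, Finset.image_image]
  simp only [hf.ne_iff]
  congr! 1

variable {V W : Type} [Fintype V] [Fintype W] (G : SimpleGraph V) (H : SimpleGraph W) (f : V → W)

open scoped Classical in
lemma profile_comp (hf : f.Injective) {t : ℕ} (u : Fin (t + 1) → V)
    (hu : ∀ i, H.degree (f (u i)) = G.degree (u i)) :
    profile H (fun i => f (u i)) = profile G u := by
  unfold profile
  rw [occurrenceRank_comp f hf]
  simp only [hu]

lemma walkStep_comp (hf : f.Injective) (lazy : Bool) {v w : V}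
    (h : simpleStep H (f v) (f w) = simpleStep G v w) :
    walkStep lazy H (f v) (f w) = walkStep lazy G v w := by
  cases lazy
  · exact h
  · simp only [walkStep, if_true, lazyStep_apply, h, PMF.pure_apply]
    by_cases hwv : w = v
    · simp [hwv]
    · simp [hwv, hf.ne hwv]

variable [MeasurableSpace V] [DiscreteMeasurableSpace V] [MeasurableSpace W]
  [DiscreteMeasurableSpace W]

-- Induction by the chain rule: inside `S` the profiles agree, so the restart decisions agree, and
-- so do the transition probabilities. Nothing is asked of the dynamics outside `S`, which is where
-- the two graphs will differ.
open scoped Classical in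
lemma restartWalkLaw_cylinder_comp (hf : f.Injective) {S : Set V}
    (hdeg : ∀ v ∈ S, H.degree (f v) = G.degree v)
    (hstep : ∀ v ∈ S, ∀ w ∈ S, simpleStep H (f v) (f w) = simpleStep G v w)
    (lazy : Bool) (restart : ProfileSpace → Bool) (x : V) (u : ℕ → V) (t : ℕ)
    (hu : ∀ i ≤ t, u i ∈ S) :
    restartWalkLaw lazy H restart (f x) {X | ∀ i ≤ t, X i = f (u i)} =
      restartWalkLaw lazy G restart x {X | ∀ i ≤ t, X i = u i} := by
  induction t with
  | zero =>
    have h1 := restartWalkLaw_start lazy G restart x {u 0}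
    have h2 := restartWalkLaw_start lazy H restart (f x) {f (u 0)}
    simp only [Nat.le_zero, forall_eq]
    simp only [Set.mem_singleton_iff] at h1 h2
    rw [h1, h2]
    simp [Set.indicator, hf.eq_iff]
  | succ t ih =>
    rw [restartWalkLaw_cylinder_succ lazy G restart x u t,
      restartWalkLaw_cylinder_succ lazy H restart (f x) (fun i => f (u i)) t,
      ih fun i hi => hu i (by omega)]
    congr 1
    unfold restartStep
    rw [profile_comp G H f hf _ fun i => hdeg _ (hu _ (by omega))]
    split_ifs
    · simp [PMF.pure_apply, hf.eq_iff]
    · exact walkStep_comp G H f hf lazy (hstep _ (hu _ (by simp)) _ (hu _ le_rfl))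

end Comparison

/-! ### Union bound for hitting a vertex -/

section Avoidance

variable {V : Type} [Fintype V] [MeasurableSpace V] [DiscreteMeasurableSpace V]
  (lazy : Bool) (G : SimpleGraph V) (restart : ProfileSpace → Bool) (x : V)

/-- If the target `b` is not the starting vertex, and is hit with probability at most `p` in one
walk step from any other vertex, then it is hit within `t` steps with probability at most `t * p`. -/
lemma restartWalkLaw_hit_le {b : V} (hx : x ≠ b) {p : ℝ≥0∞}
    (hp : ∀ v ≠ b, walkStep lazy G v b ≤ p) (t : ℕ) :
    restartWalkLaw lazy G restart x {X | ∃ i ≤ t, X i = b} ≤ t * p := by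
  classical
  induction t with
  | zero =>
    have h := restartWalkLaw_start lazy G restart x {b}
    simp only [Set.mem_singleton_iff] at h
    simp [h, hx]
  | succ t ih =>
    set μ := restartWalkLaw lazy G restart x
    -- Padding by `b` makes the cylinder of `ext' u` up to time `t + 1` the event of following `u`
    -- and then jumping to `b`.
    let ext' (u : Fin (t + 1) → V) : ℕ → V := fun i => if h : i < t + 1 then u ⟨i, h⟩ else b
    let K : Finset (Fin (t + 1) → V) := Finset.univ.filter fun u => ∀ i, u i ≠ b
    have hsub : {X : ℕ → V | ∃ i ≤ t + 1, X i = b} ⊆ {X | ∃ i ≤ t, X i = b} ∪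
        ⋃ u ∈ K, {X | ∀ i ≤ t + 1, X i = ext' u i} := by
      rintro X ⟨i, hi, hXi⟩
      by_cases h : ∃ i ≤ t, X i = b
      · exact Or.inl h
      · right
        have hi' : i = t + 1 := by
          by_contra hne
          exact h ⟨i, by omega, hXi⟩
        subst hi'
        push Not at h
        simp only [Set.mem_iUnion]
        refine ⟨fun j => X j, by simpa [K] using fun j : Fin (t + 1) => h j (by omega), ?_⟩
        intro j hj
        by_cases hjt : j < t + 1
        · simp only [ext', hjt, dif_pos]
        · obtain rfl : j = t + 1 := by omega
          simpa [ext'] using hXi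
    have hcyl : ∀ u ∈ K, μ {X | ∀ i ≤ t + 1, X i = ext' u i} ≤
        μ {X | ∀ i ≤ t, X i = ext' u i} * p := by
      intro u hu
      rw [restartWalkLaw_cylinder_succ]
      gcongr
      have hb : ext' u (t + 1) = b := by simp [ext']
      rw [hb]
      unfold restartStep
      split_ifs
      · simp [PMF.pure_apply, hx.symm]
      · apply hp
        simp only [K, Finset.mem_filter, Finset.mem_univ, true_and] at hu
        simpa only [ext', Fin.is_lt, dif_pos] using hu (Fin.last t)
    have hdisj : (K : Set (Fin (t + 1) → V)).PairwiseDisjoint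
        fun u => {X : ℕ → V | ∀ i ≤ t, X i = ext' u i} := by
      intro u _ v _ huv
      refine Set.disjoint_left.2 fun X h1 h2 => huv ?_
      funext i
      have := (h1 i (by omega)).symm.trans (h2 i (by omega))
      simpa only [ext', i.isLt, dif_pos, Fin.eta] using this
    calc μ {X : ℕ → V | ∃ i ≤ t + 1, X i = b}
        ≤ μ {X | ∃ i ≤ t, X i = b} + μ (⋃ u ∈ K, {X | ∀ i ≤ t + 1, X i = ext' u i}) :=
          (measure_mono hsub).trans (measure_union_le _ _)
      _ ≤ t * p + ∑ u ∈ K, μ {X | ∀ i ≤ t, X i = ext' u i} * p := by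
          gcongr
          exact (measure_biUnion_finset_le _ _).trans (Finset.sum_le_sum hcyl)
      -- Distinct prefixes are disjoint events, so their total mass is at most `1` and the extra
      -- step costs only `p`.
      _ = t * p + μ (⋃ u ∈ K, {X | ∀ i ≤ t, X i = ext' u i}) * p := by
          rw [← Finset.sum_mul, measure_biUnion_finset hdisj
            fun u _ => measurableSet_cylinder _ _]
      _ ≤ t * p + 1 * p := by gcongr; exact prob_le_one
      _ = (t + 1 : ℕ) * p := by push_cast; ring

end Avoidance

/-! ### Transfer of events between the two walks -/

section Transfer

variable {V W : Type} [Fintype V] [Fintype W] (G : SimpleGraph V) (H : SimpleGraph W) (f : V → W)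
  [MeasurableSpace V] [DiscreteMeasurableSpace V] [MeasurableSpace W] [DiscreteMeasurableSpace W]

/-- Events of the first walk within `S` up to time `t` are transported along `f`, on which the
second walk has the same dynamics. -/
lemma restartWalkLaw_le_comp (hf : f.Injective) {S : Set V}
    (lazy : Bool) (restart : ProfileSpace → Bool) (x : V) (t : ℕ)
    (hcyl : ∀ u : ℕ → V, (∀ i ≤ t, u i ∈ S) →
      restartWalkLaw lazy H restart (f x) {X | ∀ i ≤ t, X i = f (u i)} =
      restartWalkLaw lazy G restart x {X | ∀ i ≤ t, X i = u i})
    (A : Set (ℕ → V)) (B : Set (ℕ → W)) (hA : ∀ X ∈ A, ∀ i ≤ t, X i ∈ S)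
    (hAB : ∀ X ∈ A, ∀ Y : ℕ → W, (∀ i ≤ t, Y i = f (X i)) → Y ∈ B) :
    restartWalkLaw lazy G restart x A ≤ restartWalkLaw lazy H restart (f x) B := by
  classical
  -- The padding value is immaterial: only times up to `t` are read.
  let ext' (u : Fin (t + 1) → V) : ℕ → V := fun i => if h : i < t + 1 then u ⟨i, h⟩ else x
  have hext : ∀ (X : ℕ → V) i, i ≤ t → ext' (fun j : Fin (t + 1) => X j) i = X i := by
    intro X i hi
    simp only [ext', Nat.lt_succ_of_le hi, dif_pos]
  let K : Finset (Fin (t + 1) → V) :=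
    Finset.univ.filter fun u => ∃ X ∈ A, u = fun j : Fin (t + 1) => X j
  have hdisj : (K : Set (Fin (t + 1) → V)).PairwiseDisjoint
      fun u => {Y : ℕ → W | ∀ i ≤ t, Y i = f (ext' u i)} := by
    intro u _ v _ huv
    refine Set.disjoint_left.2 fun X h1 h2 => huv ?_
    funext i
    have := hf ((h1 i (by omega)).symm.trans (h2 i (by omega)))
    simpa only [ext', i.isLt, dif_pos, Fin.eta] using this
  calc restartWalkLaw lazy G restart x A
      ≤ restartWalkLaw lazy G restart x (⋃ u ∈ K, {X | ∀ i ≤ t, X i = ext' u i}) := by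
        refine measure_mono fun X hX => ?_
        simp only [Set.mem_iUnion]
        exact ⟨fun j => X j, by simpa [K] using ⟨X, hX, rfl⟩, fun i hi => (hext X i hi).symm⟩
    _ ≤ ∑ u ∈ K, restartWalkLaw lazy G restart x {X | ∀ i ≤ t, X i = ext' u i} :=
        measure_biUnion_finset_le _ _
    _ = ∑ u ∈ K, restartWalkLaw lazy H restart (f x) {Y | ∀ i ≤ t, Y i = f (ext' u i)} := by
        refine Finset.sum_congr rfl fun u hu => (hcyl _ fun i hi => ?_).symm
        simp only [K, Finset.mem_filter, Finset.mem_univ, true_and] at hu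
        obtain ⟨X, hX, rfl⟩ := hu
        rw [hext X i hi]
        exact hA X hX i hi
    _ = restartWalkLaw lazy H restart (f x) (⋃ u ∈ K, {Y | ∀ i ≤ t, Y i = f (ext' u i)}) :=
        (measure_biUnion_finset hdisj fun u _ =>
          measurableSet_cylinder (fun i => f (ext' u i)) t).symm
    _ ≤ restartWalkLaw lazy H restart (f x) B := by
        refine measure_mono fun Y hY => ?_
        simp only [Set.mem_iUnion] at hY
        obtain ⟨u, hu, hY⟩ := hY
        simp only [K, Finset.mem_filter, Finset.mem_univ, true_and] at hu
        obtain ⟨X, hX, rfl⟩ := hu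
        exact hAB X hX Y fun i hi => (hY i hi).trans (by rw [hext X i hi])

end Transfer

/-! ### Stopping time and answer as functions of the profiles -/

section Stopping

variable {V W : Type} [Fintype V] [Fintype W] (G : SimpleGraph V) (H : SimpleGraph W)

lemma stoppingTime_le_iff (halt : ProfileSpace → Bool) (X : ℕ → V) (t : ℕ) :
    stoppingTime G halt X ≤ t ↔ ∃ s ≤ t, halt (profileUpTo G X s) = true := by
  constructor
  · intro h
    by_contra! hc
    have : ((t + 1 : ℕ) : ℕ∞) ≤ stoppingTime G halt X := by
      refine le_iInf₂ fun s hs => ?_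
      by_contra! hlt
      exact hc s (by have := Nat.cast_lt.1 hlt; omega) hs
    exact absurd (this.trans h) (by rw [Nat.cast_le]; omega)
  · rintro ⟨s, hs, h⟩
    exact (iInf₂_le s h).trans (by exact_mod_cast hs)

lemma stoppingTime_congr {halt : ProfileSpace → Bool} {X : ℕ → V} {Y : ℕ → W} {t : ℕ}
    (h : ∀ s ≤ t, profileUpTo H Y s = profileUpTo G X s) (hX : stoppingTime G halt X ≤ t) :
    stoppingTime H halt Y = stoppingTime G halt X := by
  have hle : ∀ s ≤ t, stoppingTime H halt Y ≤ s ↔ stoppingTime G halt X ≤ s := by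
    intro s hs
    simp only [stoppingTime_le_iff]
    exact exists_congr fun r => and_congr_right fun hr => by rw [h r (hr.trans hs)]
  have hY := (hle t le_rfl).2 hX
  lift stoppingTime G halt X to ℕ using ne_top_of_le_ne_top (ENat.natCast_ne_top t) hX with a
  lift stoppingTime H halt Y to ℕ using ne_top_of_le_ne_top (ENat.natCast_ne_top t) hY with b
  simp only [Nat.cast_le] at *
  have h1 := (hle a hX).2 le_rfl
  have h2 := (hle b hY).1 le_rfl
  rw [le_antisymm h1 h2]

lemma returnedValue_congr {halt : ProfileSpace → Bool} {est : ProfileSpace → ℝ} {X : ℕ → V}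
    {Y : ℕ → W} {t : ℕ} (h : ∀ s ≤ t, profileUpTo H Y s = profileUpTo G X s)
    (hX : stoppingTime G halt X ≤ t) :
    returnedValue H halt est Y = returnedValue G halt est X := by
  unfold returnedValue
  rw [stoppingTime_congr G H h hX, h _ (ENat.toNat_le_of_le_natCast hX)]

end Stopping

/-! ### Mixing by minorization -/

section Mixing

variable {V : Type} [Fintype V] (G : SimpleGraph V)

lemma transitionMatrix_nonneg (x y : V) : 0 ≤ transitionMatrix G x y := ENNReal.toReal_nonneg

open scoped Classical in
lemma transitionMatrix_apply {x : V} (hx : 0 < G.degree x) (y : V) :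
    transitionMatrix G x y =
      (if x = y then 1 / 2 else 0) + if G.Adj x y then 1 / (2 * (G.degree x : ℝ)) else 0 := by
  have h0 : ((G.degree x : ℕ) : ℝ≥0∞)⁻¹ ≠ ⊤ := by simp; omega
  rw [transitionMatrix, Matrix.of_apply, lazyStep_apply, simpleStep_apply G hx, PMF.pure_apply,
    ENNReal.toReal_add (by split_ifs <;> simp)
      (ENNReal.mul_ne_top (by simp) (by split_ifs; exacts [h0, by simp]))]
  congr 1
  · by_cases h : x = y
    · simp [h]
    · simp [h, Ne.symm h]
  · by_cases h : G.Adj x y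
    · simp [h, mul_comm]
    · simp [h]

lemma transitionMatrix_row_sum (x : V) : ∑ y, transitionMatrix G x y = 1 := by
  simp only [transitionMatrix, Matrix.of_apply]
  rw [← ENNReal.toReal_sum fun y _ => PMF.apply_ne_top _ _, ← tsum_fintype (L := .unconditional V),
    PMF.tsum_coe]
  rfl

open scoped Classical in
lemma stationary_mul_transitionMatrix (hG : ∀ v, 0 < G.degree v) (x y : V) :
    stationary G x * transitionMatrix G x y = stationary G y * transitionMatrix G y x := by
  rw [transitionMatrix_apply G (hG x), transitionMatrix_apply G (hG y)]
  have hx : (G.degree x : ℝ) ≠ 0 := by have := hG x; positivity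
  have hy : (G.degree y : ℝ) ≠ 0 := by have := hG y; positivity
  by_cases hxy : x = y
  · subst hxy; rfl
  · unfold stationary
    by_cases h : G.Adj x y
    · simp only [hxy, Ne.symm hxy, h, h.symm, if_true, if_false]
      field_simp
      ring
    · have h' : ¬ G.Adj y x := fun h' => h h'.symm
      simp [hxy, Ne.symm hxy, h, h']

open scoped Classical in
lemma sum_stationary_mul_transitionMatrix (hG : ∀ v, 0 < G.degree v) (y : V) :
    ∑ x, stationary G x * transitionMatrix G x y = stationary G y := by
  simp_rw [stationary_mul_transitionMatrix G hG _ y, ← Finset.mul_sum, transitionMatrix_row_sum,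
    mul_one]

open scoped Classical in
lemma two_mul_card_edgeFinset_cast : 2 * (G.edgeFinset.card : ℝ) = ∑ v, (G.degree v : ℝ) := by
  exact_mod_cast (G.sum_degrees_eq_twice_card_edges).symm

open scoped Classical in
lemma sum_stationary [Nonempty V] (hG : ∀ v, 0 < G.degree v) : ∑ x, stationary G x = 1 := by
  unfold stationary
  rw [← Finset.sum_div, two_mul_card_edgeFinset_cast]
  refine div_self (ne_of_gt (Finset.sum_pos (fun v _ => ?_) Finset.univ_nonempty))
  exact_mod_cast hG v

end Mixing

/-- Geometric convergence to equilibrium of a stochastic matrix all of whose entries are at least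
the fraction `c` of those of its stationary distribution. -/
lemma abs_pow_sub_le_of_minorization {V : Type} [Fintype V] [DecidableEq V] {Q : Matrix V V ℝ}
    {p : V → ℝ} {c : ℝ} (hrow : ∀ x, ∑ y, Q x y = 1) (hp : ∑ x, p x = 1) (hp0 : ∀ x, 0 ≤ p x)
    (hstat : ∀ y, ∑ x, p x * Q x y = p y) (hc : ∀ x y, c * p y ≤ Q x y)
    (k : ℕ) (x y : V) : |(Q ^ k) x y - p y| ≤ (1 - c) ^ k := by
  have hpk : ∀ k : ℕ, ∑ z, p z * (Q ^ k) z y = p y := by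
    intro k
    induction k with
    | zero => simp [Matrix.one_apply]
    | succ k ih =>
      rw [pow_succ']
      simp_rw [Matrix.mul_apply, Finset.mul_sum]
      rw [Finset.sum_comm]
      simp_rw [← mul_assoc, ← Finset.sum_mul, hstat, ih]
  have hpy : p y ≤ 1 := hp ▸ Finset.single_le_sum (fun z _ => hp0 z) (Finset.mem_univ y)
  induction k generalizing x with
  | zero =>
    have := hp0 y
    rw [pow_zero, pow_zero, Matrix.one_apply]
    split_ifs <;> rw [abs_le] <;> constructor <;> linarith
  | succ k ih =>
    have hcentre : ∑ z, p z * ((Q ^ k) z y - p y) = 0 := by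
      simp_rw [mul_sub, Finset.sum_sub_distrib, ← Finset.sum_mul, hpk, hp, one_mul, sub_self]
    -- By `hcentre`, subtracting `c * p z` from the weights changes nothing; they stay nonnegative
    -- and now sum to `1 - c`, the contraction factor.
    have e : (Q ^ (k + 1)) x y - p y = ∑ z, (Q x z - c * p z) * ((Q ^ k) z y - p y) := by
      have h1 : ∑ z, (Q x z - c * p z) * ((Q ^ k) z y - p y) =
          (∑ z, Q x z * (Q ^ k) z y) - (∑ z, Q x z) * p y
            - c * ∑ z, p z * ((Q ^ k) z y - p y) := by
        rw [Finset.sum_mul, Finset.mul_sum, ← Finset.sum_sub_distrib, ← Finset.sum_sub_distrib]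
        exact Finset.sum_congr rfl fun z _ => by ring
      rw [h1, hcentre, hrow, pow_succ', Matrix.mul_apply]
      ring
    rw [e]
    calc |∑ z, (Q x z - c * p z) * ((Q ^ k) z y - p y)|
        ≤ ∑ z, |(Q x z - c * p z) * ((Q ^ k) z y - p y)| := Finset.abs_sum_le_sum_abs _ _
      _ ≤ ∑ z, (Q x z - c * p z) * (1 - c) ^ k := by
          refine Finset.sum_le_sum fun z _ => ?_
          rw [abs_mul, abs_of_nonneg (sub_nonneg.2 (hc x z))]
          exact mul_le_mul_of_nonneg_left (ih z) (sub_nonneg.2 (hc x z))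
      _ = (1 - c) ^ (k + 1) := by
          rw [← Finset.sum_mul, Finset.sum_sub_distrib, hrow, ← Finset.mul_sum, hp]
          ring

-- All degrees are at least `1` and their sum is at most the squared number of vertices, so the
-- stationary masses are at least the inverse of that square. The factor in `hk` thus turns an
-- absolute error into a relative one.
open scoped Classical in
lemma uniformMixingTime_le_of_minorization {V : Type} [Fintype V] [Nonempty V] {G : SimpleGraph V}
    (hG : ∀ v, 0 < G.degree v) {c : ℝ} {s : ℕ}
    (hc : ∀ x y, c * stationary G y ≤ (transitionMatrix G ^ s) x y) {k : ℕ}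
    (hk : (1 - c) ^ k * (Fintype.card V : ℝ) ^ 2 ≤ 1 / 4) :
    uniformMixingTime G ≤ (s * k : ℕ) := by
  have hrow : ∀ (t : ℕ) (x : V), ∑ y, (transitionMatrix G ^ t) x y = 1 := by
    intro t
    induction t with
    | zero => simp [Matrix.one_apply]
    | succ t ih =>
      intro x
      simp_rw [pow_succ', Matrix.mul_apply]
      rw [Finset.sum_comm]
      simp_rw [← Finset.mul_sum, ih, mul_one]
      exact transitionMatrix_row_sum G x
  have hstat : ∀ (t : ℕ) (y : V),
      ∑ x, stationary G x * (transitionMatrix G ^ t) x y = stationary G y := by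
    intro t y
    induction t with
    | zero => simp [Matrix.one_apply]
    | succ t ih =>
      simp_rw [pow_succ', Matrix.mul_apply, Finset.mul_sum]
      rw [Finset.sum_comm]
      simp_rw [← mul_assoc, ← Finset.sum_mul, sum_stationary_mul_transitionMatrix G hG, ih]
  have hsum : 2 * (G.edgeFinset.card : ℝ) ≤ (Fintype.card V : ℝ) ^ 2 := by
    rw [two_mul_card_edgeFinset_cast, sq]
    calc ∑ v, (G.degree v : ℝ) ≤ ∑ _v : V, (Fintype.card V : ℝ) :=
          Finset.sum_le_sum fun v _ => by exact_mod_cast (G.degree_lt_card_verts v).le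
      _ = _ := by simp
  have hm : 0 < 2 * (G.edgeFinset.card : ℝ) := by
    rw [two_mul_card_edgeFinset_cast]
    exact Finset.sum_pos (fun v _ => by exact_mod_cast hG v) Finset.univ_nonempty
  have hpos : ∀ y, 1 / (Fintype.card V : ℝ) ^ 2 ≤ stationary G y := by
    intro y
    unfold stationary
    have : (1 : ℝ) ≤ G.degree y := by exact_mod_cast hG y
    gcongr
  have hn : (0 : ℝ) < (Fintype.card V : ℝ) ^ 2 := by
    have : 0 < Fintype.card V := Fintype.card_pos
    positivity
  have hpos' : ∀ y, 0 < stationary G y := fun y => lt_of_lt_of_le (by positivity) (hpos y)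
  refine iInf₂_le (s * k) fun x y => ?_
  have h := abs_pow_sub_le_of_minorization (hrow s) (sum_stationary G hG)
    (fun x => (hpos' x).le) (hstat s) hc k x y
  rw [← pow_mul] at h
  rw [div_sub_one (hpos' y).ne', abs_div, abs_of_pos (hpos' y), div_le_iff₀ (hpos' y)]
  have h2 : (1 - c) ^ k ≤ 1 / 4 * (1 / (Fintype.card V : ℝ) ^ 2) := by
    rw [mul_one_div, le_div_iff₀ hn]; exact hk
  have := hpos y
  linarith

/-- The clique on the first `N` of `n` vertices, with the other `n - N` vertices attached as
leaves to vertex `0`. -/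
def hubGraph (N n : ℕ) : SimpleGraph (Fin n) where
  Adj i j := i ≠ j ∧ ((i.val < N ∧ j.val < N) ∨ i.val = 0 ∨ j.val = 0)
  symm := ⟨fun i j h => ⟨h.1.symm, by tauto⟩⟩
  loopless := ⟨fun i h => h.1 rfl⟩

/-! ### Degrees and mixing time of the clique with leaves -/

section HubGraph

variable {N n : ℕ}

lemma hubGraph_adj {i j : Fin n} : (hubGraph N n).Adj i j ↔
    i ≠ j ∧ ((i.val < N ∧ j.val < N) ∨ i.val = 0 ∨ j.val = 0) := Iff.rfl

lemma hubGraph_connected (hn : 0 < n) : (hubGraph N n).Connected := by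
  have h : ∀ i : Fin n, (hubGraph N n).Reachable ⟨0, hn⟩ i := by
    intro i
    by_cases hi : (⟨0, hn⟩ : Fin n) = i
    · rw [hi]
    · exact SimpleGraph.Adj.reachable (hubGraph_adj.2 ⟨hi, Or.inr (Or.inl rfl)⟩)
  have : Nonempty (Fin n) := ⟨⟨0, hn⟩⟩
  exact ⟨fun i j => (h i).symm.trans (h j)⟩

open scoped Classical in
lemma degree_hubGraph_hub {i : Fin n} (hi : i.val = 0) : (hubGraph N n).degree i = n - 1 := by
  have : (hubGraph N n).neighborFinset i = Finset.univ.erase i := by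
    ext j
    simp [hubGraph_adj, hi, eq_comm]
  rw [← SimpleGraph.card_neighborFinset_eq_degree, this, Finset.card_erase_of_mem (by simp)]
  simp

open scoped Classical in
lemma degree_hubGraph_clique (hn : N ≤ n) {i : Fin n} (hi : i.val ≠ 0) (hiN : i.val < N) :
    (hubGraph N n).degree i = N - 1 := by
  have : (hubGraph N n).neighborFinset i =
      (Finset.univ.filter fun j : Fin n => j.val < N).erase i := by
    ext j
    simp only [SimpleGraph.mem_neighborFinset, hubGraph_adj, Finset.mem_erase, Finset.mem_filter,
      Finset.mem_univ, true_and]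
    constructor
    · rintro ⟨h, h'⟩
      exact ⟨h.symm, by omega⟩
    · rintro ⟨h, h'⟩
      exact ⟨h.symm, by omega⟩
  rw [← SimpleGraph.card_neighborFinset_eq_degree, this,
    Finset.card_erase_of_mem (by simpa using hiN), Fin.card_filter_val_lt, min_eq_right hn]

open scoped Classical in
lemma degree_hubGraph_leaf (hN : 0 < N) {i : Fin n} (hiN : N ≤ i.val) :
    (hubGraph N n).degree i = 1 := by
  have : (hubGraph N n).neighborFinset i = {⟨0, by omega⟩} := by
    ext j
    simp only [SimpleGraph.mem_neighborFinset, hubGraph_adj, Finset.mem_singleton, Fin.ext_iff, ne_eq]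
    omega
  rw [← SimpleGraph.card_neighborFinset_eq_degree, this, Finset.card_singleton]

open scoped Classical in
lemma degree_hubGraph_pos (hN : 2 ≤ N) (hn : N ≤ n) (i : Fin n) : 0 < (hubGraph N n).degree i := by
  by_cases h0 : i.val = 0
  · rw [degree_hubGraph_hub h0]; omega
  · by_cases hi : i.val < N
    · rw [degree_hubGraph_clique hn h0 hi]; omega
    · rw [degree_hubGraph_leaf (by omega) (by omega)]; omega

open scoped Classical in
lemma le_two_mul_card_edgeFinset_hubGraph (hN : 2 ≤ N) (hn : N ≤ n) :
    (N : ℝ) * (N - 1) ≤ 2 * ((hubGraph N n).edgeFinset.card : ℝ) := by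
  rw [two_mul_card_edgeFinset_cast]
  calc (N : ℝ) * (N - 1)
      = ∑ i ∈ Finset.univ.filter (fun j : Fin n => j.val < N), ((N : ℝ) - 1) := by
        rw [Finset.sum_const, Fin.card_filter_val_lt, min_eq_right hn, nsmul_eq_mul]
    _ ≤ ∑ i ∈ Finset.univ.filter (fun j : Fin n => j.val < N), ((hubGraph N n).degree i : ℝ) := by
        refine Finset.sum_le_sum fun i hi => ?_
        have h : N - 1 ≤ (hubGraph N n).degree i := by
          by_cases h0 : i.val = 0
          · rw [degree_hubGraph_hub h0]; omega
          · rw [degree_hubGraph_clique hn h0 (by simpa using hi)]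
        rw [sub_le_iff_le_add]
        exact_mod_cast Nat.sub_le_iff_le_add.1 h
    _ ≤ _ := Finset.sum_le_sum_of_subset_of_nonneg (Finset.filter_subset _ _)
        fun _ _ _ => by positivity

/-- One two-step path suffices for each pair: enter the hub and stay there if `y` is the hub; stay
at `x` and then move if both lie in the clique; pass through the hub otherwise. With hub degree at
most `4 * N`, other degrees at most `N - 1` and total degree at least `N * (N - 1)`, each type of
target `y` yields exactly the constant `1/16`. -/
lemma minorization_hubGraph (hN : 2 ≤ N) (hn : N ≤ n) (hn4 : n ≤ 4 * N) (x y : Fin n) :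
    1 / 16 * stationary (hubGraph N n) y ≤ (transitionMatrix (hubGraph N n) ^ 2) x y := by
  classical
  set G := hubGraph N n
  set P := transitionMatrix G with hP
  have hdeg := degree_hubGraph_pos hN hn
  have hN' : (2 : ℝ) ≤ N := by exact_mod_cast hN
  have hn' : (N : ℝ) ≤ n := by exact_mod_cast hn
  have hn4' : (n : ℝ) ≤ 4 * N := by exact_mod_cast hn4
  have hpath : ∀ z {a b : ℝ}, 0 ≤ b → a ≤ P x z → b ≤ P z y → a * b ≤ (P ^ 2) x y := by
    intro z a b hb h1 h2
    rw [sq, Matrix.mul_apply]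
    refine le_trans (mul_le_mul h1 h2 hb (transitionMatrix_nonneg G x z)) ?_
    exact Finset.single_le_sum (f := fun z => P x z * P z y)
      (fun z _ => mul_nonneg (transitionMatrix_nonneg G x z) (transitionMatrix_nonneg G z y))
      (Finset.mem_univ z)
  have hstay : ∀ z, 1 / 2 ≤ P z z := fun z => by
    rw [hP, transitionMatrix_apply G (hdeg z)]; simp
  have hmove : ∀ {z w : Fin n} {d : ℝ}, (G.degree z : ℝ) ≤ d → G.Adj z w →
      1 / (2 * d) ≤ P z w := by
    intro z w d hd h
    rw [hP, transitionMatrix_apply G (hdeg z)]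
    have : (0 : ℝ) < G.degree z := by exact_mod_cast hdeg z
    simp only [h, h.ne, if_true, if_false, zero_add]
    gcongr
  have hhub : ∀ z : Fin n, z.val = 0 → (G.degree z : ℝ) ≤ 4 * N := by
    intro z hz
    rw [degree_hubGraph_hub hz, Nat.cast_sub (by omega)]
    push_cast; linarith
  have hother : ∀ z : Fin n, z.val ≠ 0 → (G.degree z : ℝ) ≤ N - 1 := by
    intro z hz
    by_cases h : z.val < N
    · rw [degree_hubGraph_clique hn hz h, Nat.cast_sub (by omega)]
      simp
    · rw [degree_hubGraph_leaf (by omega) (by omega)]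
      push_cast; linarith
  have hstat : ∀ {d : ℝ}, (G.degree y : ℝ) ≤ d → stationary G y ≤ d / (N * (N - 1)) := by
    intro d hd
    unfold stationary
    have h1 := le_two_mul_card_edgeFinset_hubGraph hN hn
    have h2 : 0 < (N : ℝ) * (N - 1) := mul_pos (by linarith) (by linarith)
    have h3 : (0 : ℝ) ≤ G.degree y := by positivity
    exact div_le_div₀ (h3.trans hd) hd h2 h1
  let b : Fin n := ⟨0, by omega⟩
  have hb : ∀ z, z ≠ b → z.val ≠ 0 := fun z hz h => hz (Fin.ext h)
  have hto : ∀ z, z ≠ b → G.Adj z b := fun z hz => hubGraph_adj.2 ⟨hz, Or.inr (Or.inr rfl)⟩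
  obtain ⟨a, ha⟩ : ∃ a : ℝ, a = N - 1 := ⟨_, rfl⟩
  have ha1 : 1 ≤ a := by linarith
  rw [← ha] at hother hstat
  have hN0 : (0 : ℝ) < N := by linarith
  have ha0 : 0 < a := by linarith
  by_cases hy : y = b
  · have h1 := hstat (hhub y (by rw [hy]))
    have h2 : 1 / 16 * (4 * N / (N * a)) ≤ 1 / (2 * a) * (1 / 2) := by
      apply le_of_eq; field_simp; norm_num
    refine le_trans (by linarith) (h2.trans ?_)
    have hyy := hstay y
    refine hpath y (by norm_num) ?_ hyy
    by_cases hxy : x = y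
    · rw [hxy]
      refine le_trans ?_ hyy
      gcongr; linarith
    · rw [hy] at hxy ⊢
      exact hmove (hother x (hb x hxy)) (hto x hxy)
  · by_cases hyN : y.val < N
    · have h1 := hstat (hother y (hb y hy))
      have h2 : 1 / 16 * (a / (N * a)) ≤ 1 / 2 * (1 / (2 * (4 * N))) := by
        apply le_of_eq; field_simp; norm_num
      refine le_trans (by linarith) (h2.trans ?_)
      by_cases hxN : x.val < N
      · refine hpath x (by positivity) (hstay x) ?_
        by_cases hxy : x = y
        · rw [hxy]
          refine le_trans ?_ (hstay y)
          gcongr; linarith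
        · refine hmove ?_ (hubGraph_adj.2 ⟨hxy, Or.inl ⟨hxN, hyN⟩⟩)
          by_cases hx : x = b
          · exact hhub x (by rw [hx])
          · have := hother x (hb x hx); linarith
      · have hx : x ≠ b := by rintro rfl; exact hxN (by change 0 < N; omega)
        refine hpath b (by positivity) ?_ (hmove (hhub b rfl) (hto y hy).symm)
        have h3 : (G.degree x : ℝ) ≤ 1 := by
          rw [degree_hubGraph_leaf (by omega) (by omega)]; simp
        have := hmove h3 (hto x hx)
        simpa using this
    · have h1 : stationary G y ≤ 1 / (N * a) :=
        hstat (by rw [degree_hubGraph_leaf (by omega) (by omega)]; simp)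
      have h2 : 1 / 16 * (1 / (N * a)) ≤ 1 / (2 * a) * (1 / (2 * (4 * N))) := by
        apply le_of_eq; field_simp; norm_num
      refine le_trans (by linarith) (h2.trans ?_)
      refine hpath b (by positivity) ?_ (hmove (hhub b rfl) (hto y hy).symm)
      by_cases hx : x = b
      · rw [hx]
        refine le_trans ?_ (hstay b)
        gcongr; linarith
      · exact hmove (hother x (hb x hx)) (hto x hx)

lemma uniformMixingTime_hubGraph_le (hN : 2 ≤ N) (hn : N ≤ n) (hn4 : n ≤ 4 * N)
    (hlog : 10 ≤ Real.log n) :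
    ((uniformMixingTime (hubGraph N n) : ℕ∞) : ℝ≥0∞) ≤ ENNReal.ofReal (Real.log (n : ℝ) ^ 3) := by
  classical
  have : Nonempty (Fin n) := ⟨⟨0, by omega⟩⟩
  set L := Real.log n with hL
  have hn0 : (0 : ℝ) < n := by have : 0 < n := by omega
                               exact_mod_cast this
  have hlog4 : Real.log 4 ≤ 3 := (Real.log_le_sub_one_of_pos (by norm_num)).trans (by norm_num)
  have hlog4' : 0 ≤ Real.log 4 := Real.log_nonneg (by norm_num)
  -- Chosen so that `exp (-k / 16) * n ^ 2 ≤ 1 / 4`.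
  set k := ⌈16 * (2 * L + Real.log 4)⌉₊ with hk
  have hk1 : 16 * (2 * L + Real.log 4) ≤ k := Nat.le_ceil _
  have hk2 : (k : ℝ) < 16 * (2 * L + Real.log 4) + 1 := Nat.ceil_lt_add_one (by linarith)
  have hsmall : (1 - 1 / 16 : ℝ) ^ k * (Fintype.card (Fin n) : ℝ) ^ 2 ≤ 1 / 4 := by
    rw [Fintype.card_fin]
    have h1 : (1 - 1 / 16 : ℝ) ^ k ≤ Real.exp (-(2 * L + Real.log 4)) := by
      calc (1 - 1 / 16 : ℝ) ^ k ≤ Real.exp (-(1 / 16)) ^ k :=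
            pow_le_pow_left₀ (by norm_num) (Real.one_sub_le_exp_neg _) _
        _ = Real.exp (k * -(1 / 16)) := (Real.exp_nat_mul _ _).symm
        _ ≤ _ := Real.exp_le_exp.2 (by linarith)
    have h2 : Real.exp (-(2 * L + Real.log 4)) = 1 / 4 / (n : ℝ) ^ 2 := by
      rw [Real.exp_neg, Real.exp_add, Real.exp_log (by norm_num), two_mul, Real.exp_add, hL,
        Real.exp_log hn0]
      field_simp
    rw [h2, le_div_iff₀ (by positivity)] at h1
    exact h1
  have h := uniformMixingTime_le_of_minorization (s := 2) (degree_hubGraph_pos hN hn)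
    (fun x y => by convert! minorization_hubGraph hN hn hn4 x y) hsmall
  calc ((uniformMixingTime (hubGraph N n) : ℕ∞) : ℝ≥0∞) ≤ (((2 * k : ℕ) : ℕ∞) : ℝ≥0∞) := by
        exact_mod_cast h
    _ = ENNReal.ofReal ((2 * k : ℕ) : ℝ) := by simp
    _ ≤ ENNReal.ofReal (L ^ 3) := by
        refine ENNReal.ofReal_le_ofReal ?_
        push_cast
        -- Here `2 * k ≤ 64 * L + 98`, which is below `L ^ 3` once `L ≥ 10`.
        nlinarith [mul_nonneg (sub_nonneg.2 hlog) (sq_nonneg L), mul_nonneg (sub_nonneg.2 hlog)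
          (sub_nonneg.2 hlog)]

end HubGraph

/-! ### Indistinguishability of the two graphs -/

open scoped Classical in
lemma simpleStep_hubGraph_castLE {N n : ℕ} (hN : 2 ≤ N) (hn : N ≤ n) {v : Fin N} (hv : v.val ≠ 0)
    (w : Fin N) :
    simpleStep (hubGraph N n) (Fin.castLE hn v) (Fin.castLE hn w) =
      simpleStep (hubGraph N N) v w := by
  rw [simpleStep_apply _ (degree_hubGraph_pos hN hn _),
    simpleStep_apply _ (degree_hubGraph_pos hN le_rfl _),
    degree_hubGraph_clique hn (i := Fin.castLE hn v) hv v.isLt,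
    degree_hubGraph_clique le_rfl hv v.isLt]
  simp [hubGraph_adj]

lemma restartWalkLaw_hubGraph_hit_le {N : ℕ} (hN : 2 ≤ N) (lazy : Bool)
    (restart : ProfileSpace → Bool) {x b : Fin N} (hb : b.val = 0) (hx : x ≠ b) :
    restartWalkLaw lazy (hubGraph N N) restart x {X | ∃ i ≤ N / 4, X i = b} ≤ 1 / 2 := by
  classical
  refine (restartWalkLaw_hit_le lazy (hubGraph N N) restart x hx
    (p := ((N - 1 : ℕ) : ℝ≥0∞)⁻¹) (fun v hv => ?_) (N / 4)).trans ?_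
  · refine (walkStep_apply_le _ lazy hv.symm).trans ?_
    rw [simpleStep_apply _ (degree_hubGraph_pos hN le_rfl _),
      degree_hubGraph_clique le_rfl (fun h => hv (Fin.ext (h.trans hb.symm))) v.isLt]
    split_ifs <;> simp
  · have h1 : ((N - 1 : ℕ) : ℝ≥0∞) ≠ 0 := by
      rw [Nat.cast_ne_zero]; omega
    rw [← div_eq_mul_inv, ENNReal.div_le_iff h1 (ENNReal.natCast_ne_top _), mul_comm, mul_one_div,
      ENNReal.le_div_iff_mul_le (by simp) (by simp)]
    have : N / 4 * 2 ≤ N - 1 := by omega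
    exact_mod_cast this

/-- The trajectories on which the walk stops late or the returned value is far from `n`. -/
def failureSet {n : ℕ} (δ : ℝ) (G : SimpleGraph (Fin n)) (halt : ProfileSpace → Bool)
    (est : ProfileSpace → ℝ) : Set (ℕ → Fin n) :=
  {X | ENNReal.ofReal (δ * (n : ℝ)) ≤ ((stoppingTime G halt X : ℕ∞) : ℝ≥0∞) ∨
    1 / 2 < |returnedValue G halt est X / (n : ℝ) - 1|}

/-- A rule cannot succeed on both the clique on `N` vertices and the clique with `3 * N` leaves
attached to one vertex. -/
lemma failure_hubGraph {N : ℕ} (hN : 2 ≤ N) (lazy : Bool) (restart halt : ProfileSpace → Bool)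
    (est : ProfileSpace → ℝ) {x : Fin N} (hx : x.val ≠ 0) :
    1 / 4 ≤ restartWalkLaw lazy (hubGraph N N) restart x
        (failureSet (1 / 4) (hubGraph N N) halt est) ∨
      1 / 4 ≤ restartWalkLaw lazy (hubGraph N (4 * N)) restart (Fin.castLE (by omega) x)
        (failureSet (1 / 4) (hubGraph N (4 * N)) halt est) := by
  classical
  have hn : N ≤ 4 * N := by omega
  set f : Fin N → Fin (4 * N) := Fin.castLE hn with hf
  have hinj : f.Injective := Fin.castLE_injective hn
  set b : Fin N := ⟨0, by omega⟩ with hb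
  set G := hubGraph N N with hG
  set H := hubGraph N (4 * N) with hH
  set μ := restartWalkLaw lazy G restart x with hμ
  have hS : ∀ {v : Fin N}, v ≠ b → v.val ≠ 0 := fun hv h => hv (Fin.ext h)
  have hdeg : ∀ v ∈ {v : Fin N | v ≠ b}, H.degree (f v) = G.degree v := by
    intro v hv
    rw [degree_hubGraph_clique hn (i := f v) (hS hv) v.isLt,
      degree_hubGraph_clique le_rfl (hS hv) v.isLt]
  -- Success on the clique without seeing the hub: the event that becomes a failure on the larger
  -- graph.
  set A : Set (ℕ → Fin N) := {X | (∀ i ≤ N / 4, X i ≠ b) ∧ X ∉ failureSet (1 / 4) G halt est}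
    with hA
  have hN0 : (0 : ℝ) < N := by have : 0 < N := by omega
                               exact_mod_cast this
  have htransfer : μ A ≤ restartWalkLaw lazy H restart (f x) (failureSet (1 / 4) H halt est) := by
    refine restartWalkLaw_le_comp G H f hinj (S := {v | v ≠ b}) lazy restart x (N / 4) ?_ A _
      (fun X hX => hX.1) ?_
    · exact fun u hu => restartWalkLaw_cylinder_comp G H f hinj hdeg
        (fun v hv w _ => simpleStep_hubGraph_castLE hN hn (hS hv) w) lazy restart x u _ hu
    · rintro X ⟨hXb, hX⟩ Y hY
      have hprof : ∀ s ≤ N / 4, profileUpTo H Y s = profileUpTo G X s := by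
        intro s hs
        unfold profileUpTo
        rw [← profile_comp G H f hinj _ fun i => hdeg _ (hXb _ (by omega))]
        congr 1
        funext i
        exact hY _ (by omega)
      simp only [failureSet, Set.mem_ofPred_eq, not_or, not_le, not_lt] at hX
      obtain ⟨hτ, hest⟩ := hX
      -- Success forces `4 * τ < N`, so the integer part of `N / 4` is a long enough horizon.
      have hτN : stoppingTime G halt X ≤ (N / 4 : ℕ) := by
        have hne : stoppingTime G halt X ≠ ⊤ := by
          intro h
          simp [h] at hτ
        lift stoppingTime G halt X to ℕ using hne with s
        rw [ENat.toENNReal_coe, ← ENNReal.ofReal_natCast,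
          ENNReal.ofReal_lt_ofReal_iff (by positivity)] at hτ
        have : 4 * s < N := by
          have : (4 * s : ℝ) < N := by linarith
          exact_mod_cast this
        rw [Nat.cast_le]
        omega
      -- The common answer is at most `3 * N / 2`, hence at most `3/8` of `4 * N`, a relative error
      -- of at least `5/8`.
      right
      rw [returnedValue_congr G H hprof hτN]
      have h1 := (abs_le.1 hest).2
      have h2 : returnedValue G halt est X / N ≤ 3 / 2 := by linarith
      rw [div_le_iff₀ hN0] at h2
      have h3 : returnedValue G halt est X / ((4 * N : ℕ) : ℝ) ≤ 3 / 8 := by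
        rw [div_le_iff₀ (by push_cast; positivity)]
        push_cast
        linarith
      rw [lt_abs]
      right
      linarith
  by_contra! hcon
  obtain ⟨hc1, hc2⟩ := hcon
  have hcover : (Set.univ : Set (ℕ → Fin N)) ⊆
      {X | ∃ i ≤ N / 4, X i = b} ∪ (failureSet (1 / 4) G halt est ∪ A) := by
    intro X _
    by_cases h1 : ∃ i ≤ N / 4, X i = b
    · exact Or.inl h1
    · push Not at h1
      by_cases h2 : X ∈ failureSet (1 / 4) G halt est
      · exact Or.inr (Or.inl h2)
      · exact Or.inr (Or.inr ⟨h1, h2⟩)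
  -- Hitting the hub, failing on the clique and `A` cover everything. If both failure probabilities
  -- were below `1/4`, the total mass would be strictly below `1`.
  have hlt : (1 : ℝ≥0∞) < 1 / 2 + (1 / 4 + 1 / 4) := by
    calc (1 : ℝ≥0∞) = μ Set.univ := measure_univ.symm
      _ ≤ μ {X | ∃ i ≤ N / 4, X i = b} + (μ (failureSet (1 / 4) G halt est) + μ A) :=
          (measure_mono hcover).trans ((measure_union_le _ _).trans
            (add_le_add le_rfl (measure_union_le _ _)))
      _ < 1 / 2 + (1 / 4 + 1 / 4) :=
          ENNReal.add_lt_add_of_le_of_lt (measure_ne_top _ _)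
            (restartWalkLaw_hubGraph_hit_le hN lazy restart rfl fun h => hx (by rw [h]))
            (ENNReal.add_lt_add hc1 (htransfer.trans_lt hc2))
  refine absurd hlt (not_lt.2 (le_of_eq ?_))
  rw [← ENNReal.toReal_eq_toReal_iff' (by simp) (by simp),
    ENNReal.toReal_add (by simp) (by simp), ENNReal.toReal_add (by simp) (by simp)]
  norm_num

end SelfStopping

theorem proposition4 :
    ∃ δ : ℝ, 0 < δ ∧
      ∀ (lazy : Bool) (restart halt : SelfStopping.ProfileSpace → Bool)
        (est : SelfStopping.ProfileSpace → ℝ),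
        {n : ℕ | ∃ (G : SimpleGraph (Fin n)) (x : Fin n),
          G.Connected ∧
          ((SelfStopping.uniformMixingTime G : ℕ∞) : ℝ≥0∞) ≤
            ENNReal.ofReal (Real.log (n : ℝ) ^ 3) ∧
          1 / 4 ≤ SelfStopping.restartWalkLaw lazy G restart x
            {X : ℕ → Fin n |
              ENNReal.ofReal (δ * (n : ℝ)) ≤
                ((SelfStopping.stoppingTime G halt X : ℕ∞) : ℝ≥0∞) ∨
              1 / 2 < |SelfStopping.returnedValue G halt est X / (n : ℝ) - 1|}}.Infinite := by
  refine ⟨1 / 4, by norm_num, fun lazy restart halt est => ?_⟩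
  refine Set.infinite_of_forall_exists_gt fun a => ?_
  -- Whichever of `N` and `4 * N` is the bad size, it exceeds `a`; the bound by `Real.exp 10` serves
  -- the mixing estimate.
  obtain ⟨N, hNa, hN2, hNexp⟩ : ∃ N : ℕ, a < N ∧ 2 ≤ N ∧ Real.exp 10 ≤ N :=
    ⟨a + 2 + ⌈Real.exp 10⌉₊, by omega, by omega,
      (Nat.le_ceil _).trans (by exact_mod_cast Nat.le_add_left _ _)⟩
  have hlog : ∀ n : ℕ, N ≤ n → 10 ≤ Real.log n := by
    intro n hn
    have hle : Real.exp 10 ≤ n := hNexp.trans (by exact_mod_cast hn)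
    rwa [Real.le_log_iff_exp_le ((Real.exp_pos _).trans_le hle)]
  have h4 : N ≤ 4 * N := by omega
  rcases SelfStopping.failure_hubGraph hN2 lazy restart halt est
    (x := ⟨1, by omega⟩) one_ne_zero with h | h
  · exact ⟨N, ⟨SelfStopping.hubGraph N N, _, SelfStopping.hubGraph_connected (by omega),
      SelfStopping.uniformMixingTime_hubGraph_le hN2 le_rfl h4 (hlog N le_rfl), h⟩, hNa⟩
  · exact ⟨4 * N, ⟨SelfStopping.hubGraph N (4 * N), _, SelfStopping.hubGraph_connected (by omega),
      SelfStopping.uniformMixingTime_hubGraph_le hN2 h4 le_rfl (hlog _ h4), h⟩, by omega⟩
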